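/- Let $M$ and $N$ be two connected complex manifolds (Hausdorff and second countable) of the same complex dimension $n$, and let $f:M\to N$ be a holomorphic map such that 1. $f$ has at least one regular point, i.e. there is a point $p\in M$ at which the differential $df_p:T_pM\to T_{f(p)}N$ is surjective; 2. $f(M)$ is closed in $N$. Then $f$ is surjective. -/

import Mathlib

open scoped Manifold ContDiff

open Set Filter Topology Module
open scoped NNReal ENNReal

/-! The interior of `range f` is nonempty, since `f` is open near a regular point; as `N` is
connected, it suffices that this interior is closed. A point of the closed set `range f` outside its
interior is a critical value. By the identity theorem for the Jacobian determinant, the critical set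
is a nowhere dense analytic set, so critical values have Hausdorff dimension at most `2n - 2` in
charts (`dimH_chart_image_criticalSet_le`). That is too small to separate a ball into the interior
and the complement of the range (`Convex.not_separated_of_dimH_lt`). -/

/-- A closed set of Hausdorff dimension less than `dim E - 1` does not separate a convex open set. -/
theorem Convex.not_separated_of_dimH_lt {E : Type*} [NormedAddCommGroup E] [NormedSpace ℝ E]
    [FiniteDimensional ℝ E] {B U V : Set E} (hBc : Convex ℝ B) (hBo : IsOpen B)
    (hU : IsOpen U) (hV : IsOpen V) (hUV : Disjoint U V)
    (hBU : (B ∩ U).Nonempty) (hBV : (B ∩ V).Nonempty)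
    (hdim : dimH (B \ (U ∪ V)) < (finrank ℝ E - 1 : ℕ)) : False := by
  obtain ⟨b, hbB, hbU⟩ := hBU
  obtain ⟨a, haB, haV⟩ := hBV
  have hab : a - b ≠ 0 := fun h ↦ by
    rw [sub_eq_zero] at h
    exact hUV.ne_of_mem hbU haV h.symm
  obtain ⟨l, hl⟩ := SeparatingDual.exists_eq_one (R := ℝ) hab
  have hfin : finrank ℝ l.ker = finrank ℝ E - 1 := by
    have h1 := LinearMap.finrank_range_add_finrank_ker (l : E →ₗ[ℝ] ℝ)
    have h2 : LinearMap.range (l : E →ₗ[ℝ] ℝ) = ⊤ := by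
      apply LinearMap.range_eq_top.2
      intro y
      exact ⟨y • (a - b), by simp [map_smul, -map_sub, hl]⟩
    rw [h2, finrank_top, finrank_self] at h1
    change finrank ℝ (LinearMap.ker (l : E →ₗ[ℝ] ℝ)) = _
    omega
  -- Projection along `a - b`: a translate of the segment from `b` to `a` lies in one fibre, so over
  -- a point `s` outside the image of the bad set it stays in `U ∪ V`.
  let π : E →L[ℝ] l.ker :=
    (ContinuousLinearMap.id ℝ E - l.smulRight (a - b)).codRestrict l.ker (fun x ↦ by
      change l (x - l x • (a - b)) = 0
      rw [map_sub, map_smul, hl]; simp)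
  have hπ : ∀ x, (π x : E) = x - l x • (a - b) := fun x ↦ rfl
  have hdense : Dense (π '' (B \ (U ∪ V)))ᶜ := by
    apply dense_compl_of_dimH_lt_finrank
    rw [hfin]
    exact (π.lipschitz.dimH_image_le _).trans_lt hdim
  have hopen : IsOpen {s : l.ker | b + ((s : E) - π b) ∈ B ∩ U ∧ a + ((s : E) - π b) ∈ B ∩ V} :=
    ((hBo.inter hU).preimage (by fun_prop)).inter ((hBo.inter hV).preimage (by fun_prop))
  -- At `s = π b` the translation is zero, so the open set is nonempty.
  obtain ⟨s, ⟨⟨hs1, hs2⟩, hs3, hs4⟩, hs⟩ := hdense.inter_open_nonempty _ hopen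
    ⟨π b, by simp [hbB, hbU, haB, haV]⟩
  set b' := b + ((s : E) - π b) with hb'
  set a' := a + ((s : E) - π b) with ha'
  have hseg : segment ℝ b' a' ⊆ U ∪ V := by
    intro x hx
    by_contra hxUV
    refine hs ⟨x, ⟨hBc.segment_subset hs1 hs3 hx, hxUV⟩, ?_⟩
    rw [segment_eq_image'] at hx
    obtain ⟨θ, -, rfl⟩ := hx
    have hls : l (s : E) = 0 := s.2
    have hlb : l (π b : E) = 0 := (π b).2
    have h1 : a' - b' = a - b := by rw [ha', hb']; abel
    apply Subtype.ext
    simp only [hπ, h1]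
    rw [map_add, map_smul, hl, hb', map_add, map_sub, hls, hlb, hπ]
    simp only [smul_eq_mul, mul_one, sub_zero, add_zero, add_smul]
    abel
  obtain ⟨x, -, hxU, hxV⟩ := (convex_segment (𝕜 := ℝ) b' a').isPreconnected U V hU hV hseg
    ⟨b', left_mem_segment ℝ _ _, hs2⟩ ⟨a', right_mem_segment ℝ _ _, hs4⟩
  exact hUV.ne_of_mem hxU hxV rfl

/-! ### Zeros and critical values of analytic maps -/

section Complex

variable {E W : Type*} [NormedAddCommGroup E] [NormedSpace ℂ E] [FiniteDimensional ℂ E]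
  [NormedAddCommGroup W] [NormedSpace ℂ W]

/-- Some functional `l ∘ F` has nonzero derivative, so near `x` the zeros lie in the image of a
Lipschitz implicit function on a complex hyperplane. -/
theorem exists_mem_nhds_dimH_zeros_le {F : E → W} {x : E} (hF : AnalyticAt ℂ F x) (hx : F x = 0)
    (hF' : fderiv ℂ F x ≠ 0) :
    ∃ U ∈ 𝓝 x, dimH (U ∩ {y | F y = 0}) ≤ (finrank ℝ E - 2 : ℕ) := by
  have : CompleteSpace E := FiniteDimensional.complete ℂ E
  obtain ⟨v, hv⟩ : ∃ v, fderiv ℂ F x v ≠ 0 := by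
    by_contra! h
    exact hF' (ContinuousLinearMap.ext h)
  obtain ⟨l, hl⟩ := SeparatingDual.exists_ne_zero (R := ℂ) hv
  set h' : E →L[ℂ] ℂ := l.comp (fderiv ℂ F x) with hh'
  have hh : HasStrictFDerivAt (fun y ↦ l (F y)) h' x :=
    l.hasStrictFDerivAt.comp x hF.hasStrictFDerivAt
  have hr : h'.range = ⊤ := by
    apply LinearMap.range_eq_top.2
    intro y
    refine ⟨(y / l (fderiv ℂ F x v)) • v, ?_⟩
    change l (fderiv ℂ F x _) = y
    rw [map_smul, map_smul, smul_eq_mul, div_mul_cancel₀ _ hl]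
  have hfin : finrank ℝ h'.ker = finrank ℝ E - 2 := by
    have h1 := LinearMap.finrank_range_add_finrank_ker (h' : E →ₗ[ℂ] ℂ)
    have h2 : LinearMap.range (h' : E →ₗ[ℂ] ℂ) = ⊤ := hr
    rw [h2, finrank_top, finrank_self] at h1
    rw [finrank_real_of_complex, finrank_real_of_complex]
    change 2 * finrank ℂ (LinearMap.ker (h' : E →ₗ[ℂ] ℂ)) = _
    omega
  obtain ⟨K, s, hs, hK⟩ := (hh.to_implicitFunction hr).exists_lipschitzOnWith
  have hproj : ContinuousAt
      (fun y ↦ (hh.implicitToOpenPartialHomeomorph (fun y ↦ l (F y)) h' hr y).2) x :=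
    continuousAt_snd.comp ((hh.implicitToOpenPartialHomeomorph _ h' hr).continuousAt
      (hh.mem_implicitToOpenPartialHomeomorph_source hr))
  have hmem : ∀ᶠ y in 𝓝 x,
      (hh.implicitToOpenPartialHomeomorph (fun y ↦ l (F y)) h' hr y).2 ∈ s := by
    apply hproj.eventually_mem
    rwa [hh.implicitToOpenPartialHomeomorph_self hr]
  refine ⟨_, hmem.and (hh.eq_implicitFunction hr), ?_⟩
  rw [← hfin, ← Real.dimH_univ_eq_finrank h'.ker]
  refine (dimH_mono ?_).trans (hK.dimH_image_le.trans (dimH_mono (subset_univ s)))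
  rintro y ⟨⟨hy1, hy2⟩, hy3⟩
  refine ⟨_, hy1, ?_⟩
  have hy3 : F y = 0 := hy3
  simpa only [hx, hy3] using hy2

omit [FiniteDimensional ℂ E] in
theorem AnalyticAt.eventually_eq_zero_of_iteratedFDeriv [CompleteSpace W] {g : E → W} {x : E}
    (hg : AnalyticAt ℂ g x) (h : ∀ k, iteratedFDeriv ℂ k g x = 0) : ∀ᶠ y in 𝓝 x, g y = 0 := by
  obtain ⟨p, r, hp⟩ := hg
  filter_upwards [Metric.eball_mem_nhds x hp.r_pos] with y hy
  have h1 := hp.hasSum_iteratedFDeriv (y := y - x) (by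
    rw [Metric.mem_eball] at hy ⊢
    rwa [edist_zero_right, ← edist_eq_enorm_sub])
  simp only [h, _root_.zero_apply, smul_zero, add_sub_cancel] at h1
  exact h1.unique hasSum_zero

/-- Sort the zeros by vanishing order: just below the first nonzero derivative, the `k`-th
derivative vanishes but its own derivative does not, so the previous lemma applies to each of
countably many pieces. -/
theorem AnalyticOnNhd.dimH_zeros_le [CompleteSpace W] {g : E → W} {Ω : Set E}
    (hg : AnalyticOnNhd ℂ g Ω) (hne : ∀ x ∈ Ω, ¬ ∀ᶠ y in 𝓝 x, g y = 0) :
    dimH (Ω ∩ {x | g x = 0}) ≤ (finrank ℝ E - 2 : ℕ) := by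
  have : ProperSpace E := FiniteDimensional.proper ℂ E
  let Z : ℕ → Set E := fun k ↦ {x ∈ Ω | iteratedFDeriv ℂ k g x = 0 ∧
    fderiv ℂ (iteratedFDeriv ℂ k g) x ≠ 0}
  have hsub : Ω ∩ {x | g x = 0} ⊆ ⋃ k, Z k := by
    classical
    rintro x ⟨hx, hgx⟩
    have hex : ∃ k, iteratedFDeriv ℂ k g x ≠ 0 := by
      by_contra! h
      exact hne x hx ((hg x hx).eventually_eq_zero_of_iteratedFDeriv h)
    have h0 : Nat.find hex ≠ 0 := by
      intro h
      have := Nat.find_spec hex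
      rw [h] at this
      apply this
      ext m
      simpa using hgx
    obtain ⟨k, hk⟩ := Nat.exists_eq_succ_of_ne_zero h0
    refine mem_iUnion.2 ⟨k, hx, ?_, ?_⟩
    · exact not_not.1 (Nat.find_min hex (m := k) (by omega))
    · have := Nat.find_spec hex
      rw [hk] at this
      rw [fderiv_iteratedFDeriv]
      exact (LinearIsometryEquiv.map_eq_zero_iff _).not.2 this
  refine (dimH_mono hsub).trans ?_
  rw [dimH_iUnion]
  refine iSup_le fun k ↦ le_of_not_gt fun hlt ↦ ?_
  obtain ⟨x, ⟨hxΩ, hx0, hx1⟩, hx⟩ := exists_mem_nhdsWithin_lt_dimH_of_lt_dimH hlt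
  obtain ⟨U, hU, hUd⟩ := exists_mem_nhds_dimH_zeros_le (hg.iteratedFDeriv k x hxΩ) hx0 hx1
  refine (hx (U ∩ {y | iteratedFDeriv ℂ k g y = 0}) ?_).not_ge hUd
  filter_upwards [mem_nhdsWithin_of_mem_nhds hU, self_mem_nhdsWithin] with y hy hy'
  exact ⟨hy, hy'.2.1⟩

theorem AnalyticAt.continuousLinearMap_det {F : E → (E →L[ℂ] E)} {x : E} (hF : AnalyticAt ℂ F x) :
    AnalyticAt ℂ (fun y ↦ (F y).det) x := by
  have : CompleteSpace E := FiniteDimensional.complete ℂ E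
  let b := finBasis ℂ E
  have h : ∀ y, (F y).det = ∑ σ : Equiv.Perm (Fin (finrank ℂ E)),
      (Equiv.Perm.sign σ : ℂ) *
        ∏ i, (b.coord (σ i)).toContinuousLinearMap (F y (b i)) := by
    intro y
    rw [ContinuousLinearMap.det, ← LinearMap.det_toMatrix b, Matrix.det_apply']
    simp [LinearMap.toMatrix_apply]
  simp_rw [h]
  refine Finset.analyticAt_fun_sum _ fun σ _ ↦ analyticAt_const.mul ?_
  refine Finset.analyticAt_fun_prod _ fun i _ ↦ ?_
  exact (ContinuousLinearMap.analyticAt _ _).comp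
    ((ContinuousLinearMap.apply ℂ E (b i)).analyticAt _ |>.comp hF)

theorem ContinuousLinearMap.surjective_iff_det_ne_zero (A : E →L[ℂ] E) :
    Function.Surjective A ↔ A.det ≠ 0 := by
  rw [ContinuousLinearMap.det, Ne, LinearMap.det_eq_zero_iff_ker_ne_bot, not_not,
    LinearMap.ker_eq_bot_iff_range_eq_top, LinearMap.range_eq_top]
  rfl

/-- Critical points are the zeros of the determinant, and a locally Lipschitz map does not raise
dimension. -/
theorem AnalyticOnNhd.dimH_image_critical_le {F : E → E} {Ω : Set E} (hF : AnalyticOnNhd ℂ F Ω)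
    (hne : ∀ x ∈ Ω, ¬ ∀ᶠ y in 𝓝 x, ¬ Function.Surjective (fderiv ℂ F y)) :
    dimH (F '' {x ∈ Ω | ¬ Function.Surjective (fderiv ℂ F x)}) ≤ (finrank ℝ E - 2 : ℕ) := by
  have : ProperSpace E := FiniteDimensional.proper ℂ E
  simp only [ContinuousLinearMap.surjective_iff_det_ne_zero, not_not] at hne ⊢
  refine le_trans ?_ (AnalyticOnNhd.dimH_zeros_le
    (fun x hx ↦ (hF x hx).fderiv.continuousLinearMap_det) hne)
  refine dimH_image_le_of_locally_lipschitzOn fun x hx ↦ ?_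
  obtain ⟨K, s, hs, hK⟩ := (hF x hx.1).hasStrictFDerivAt.exists_lipschitzOnWith
  exact ⟨K, s, mem_nhdsWithin_of_mem_nhds hs, hK⟩

theorem AnalyticOnNhd.forall_not_surjective_fderiv {F : E → E} {Ω : Set E}
    (hF : AnalyticOnNhd ℂ F Ω) (hΩ : IsPreconnected Ω) {x : E} (hx : x ∈ Ω)
    (h : ∀ᶠ y in 𝓝 x, ¬ Function.Surjective (fderiv ℂ F y)) :
    ∀ y ∈ Ω, ¬ Function.Surjective (fderiv ℂ F y) := by
  have : CompleteSpace E := FiniteDimensional.complete ℂ E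
  simp only [ContinuousLinearMap.surjective_iff_det_ne_zero, not_not] at h ⊢
  exact AnalyticOnNhd.eqOn_zero_of_preconnected_of_eventuallyEq_zero
    (fun x hx ↦ (hF x hx).fderiv.continuousLinearMap_det) hΩ hx h

end Complex

/-! ### Critical points and values on manifolds -/

section Manifold

variable {E : Type*} [NormedAddCommGroup E] [NormedSpace ℂ E]
  {M : Type*} [TopologicalSpace M] [ChartedSpace E M] [IsManifold 𝓘(ℂ, E) ω M]
  {N : Type*} [TopologicalSpace N] [ChartedSpace E N] [IsManifold 𝓘(ℂ, E) ω N]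
  {f : M → N}

/-- The expression of `f` in the preferred charts at `x` and `y`. -/
noncomputable abbrev chartExpr (E : Type*) [NormedAddCommGroup E] [NormedSpace ℂ E] {M : Type*}
    [TopologicalSpace M] [ChartedSpace E M] {N : Type*} [TopologicalSpace N] [ChartedSpace E N]
    (f : M → N) (x : M) (y : N) : E → E :=
  extChartAt 𝓘(ℂ, E) y ∘ f ∘ (extChartAt 𝓘(ℂ, E) x).symm

/-- The domain on which `chartExpr` is meaningful. -/
abbrev chartDomain (E : Type*) [NormedAddCommGroup E] [NormedSpace ℂ E] {M : Type*}
    [TopologicalSpace M] [ChartedSpace E M] {N : Type*} [TopologicalSpace N] [ChartedSpace E N]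
    (f : M → N) (x : M) (y : N) : Set E :=
  (extChartAt 𝓘(ℂ, E) x).target ∩
    (extChartAt 𝓘(ℂ, E) x).symm ⁻¹' (f ⁻¹' (extChartAt 𝓘(ℂ, E) y).source)

/-- The critical points of `f`. -/
def criticalSet (E : Type*) [NormedAddCommGroup E] [NormedSpace ℂ E] {M : Type*}
    [TopologicalSpace M] [ChartedSpace E M] {N : Type*} [TopologicalSpace N] [ChartedSpace E N]
    (f : M → N) : Set M :=
  {p | ¬ Function.Surjective (mfderiv 𝓘(ℂ, E) 𝓘(ℂ, E) f p)}

omit [IsManifold 𝓘(ℂ, E) ω M] [IsManifold 𝓘(ℂ, E) ω N] in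
theorem isOpen_chartDomain (hf : Continuous f) (x : M) (y : N) :
    IsOpen (chartDomain E f x y) :=
  (continuousOn_extChartAt_symm x).isOpen_inter_preimage (isOpen_extChartAt_target x)
    ((isOpen_extChartAt_source y).preimage hf)

theorem analyticOnNhd_chartExpr (hf : ContMDiff 𝓘(ℂ, E) 𝓘(ℂ, E) ω f) (x : M) (y : N) :
    AnalyticOnNhd ℂ (chartExpr E f x y) (chartDomain E f x y) := fun _ hz ↦
  (((contMDiff_iff.1 hf).2 x y).contDiffAt
    ((isOpen_chartDomain hf.continuous x y).mem_nhds hz)).analyticAt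

theorem surjective_fderiv_chartExpr_iff (hf : ContMDiff 𝓘(ℂ, E) 𝓘(ℂ, E) ω f) {x : M} {y : N}
    {z : E} (hz : z ∈ chartDomain E f x y) :
    Function.Surjective (fderiv ℂ (chartExpr E f x y) z) ↔
      (extChartAt 𝓘(ℂ, E) x).symm z ∉ criticalSet E f := by
  have : IsManifold 𝓘(ℂ, E) 1 M := IsManifold.of_le (n := ω) le_top
  have : IsManifold 𝓘(ℂ, E) 1 N := IsManifold.of_le (n := ω) le_top
  obtain ⟨hz1, hz2⟩ := hz
  have hr : range 𝓘(ℂ, E) = univ := ModelWithCorners.range_eq_univ _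
  have d1 := mdifferentiableWithinAt_extChartAt_symm (I := 𝓘(ℂ, E)) hz1
  have i1 := isInvertible_mfderivWithin_extChartAt_symm (I := 𝓘(ℂ, E)) hz1
  rw [hr, mdifferentiableWithinAt_univ] at d1
  rw [hr, mfderivWithin_univ] at i1
  have i2 := isInvertible_mfderiv_extChartAt (I := 𝓘(ℂ, E)) hz2
  have d2 := mdifferentiableAt_extChartAt (I := 𝓘(ℂ, E)) (x := y)
    ((extChartAt_source 𝓘(ℂ, E) y) ▸ hz2)
  have d3 := (hf.mdifferentiable (by simp)) ((extChartAt 𝓘(ℂ, E) x).symm z)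
  rw [← mfderiv_eq_fderiv, mfderiv_comp z d2 (d3.comp z d1), mfderiv_comp z d3 d1]
  refine Iff.trans ?_ not_not.symm
  change Function.Surjective (mfderiv 𝓘(ℂ, E) 𝓘(ℂ, E) (extChartAt 𝓘(ℂ, E) y) _ ∘
    mfderiv 𝓘(ℂ, E) 𝓘(ℂ, E) f _ ∘ mfderiv 𝓘(ℂ, E) 𝓘(ℂ, E) (extChartAt 𝓘(ℂ, E) x).symm z) ↔ _
  exact (Function.Surjective.of_comp_iff' i2.bijective _).trans
    (Function.Surjective.of_comp_iff _ i1.surjective)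

variable [FiniteDimensional ℂ E]

theorem range_mem_nhds_of_notMem_criticalSet (hf : ContMDiff 𝓘(ℂ, E) 𝓘(ℂ, E) ω f) {p : M}
    (hp : p ∉ criticalSet E f) : range f ∈ 𝓝 (f p) := by
  have : CompleteSpace E := FiniteDimensional.complete ℂ E
  set φ := extChartAt 𝓘(ℂ, E) p with hφ
  set ψ := extChartAt 𝓘(ℂ, E) (f p) with hψ
  have hpφ : φ.symm (φ p) = p := φ.left_inv (mem_extChartAt_source p)
  have hz : φ p ∈ chartDomain E f p (f p) :=
    ⟨φ.map_source (mem_extChartAt_source p), by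
      change f (φ.symm (φ p)) ∈ (extChartAt 𝓘(ℂ, E) (f p)).source
      rw [hpφ]; exact mem_extChartAt_source _⟩
  have hs := (surjective_fderiv_chartExpr_iff hf hz).2 (by
    change φ.symm (φ p) ∉ _
    rwa [hpφ])
  have hmap := (analyticOnNhd_chartExpr hf p (f p) _ hz).hasStrictFDerivAt.map_nhds_eq_of_surj
    (LinearMap.range_eq_top.2 hs)
  have hval : chartExpr E f p (f p) (φ p) = ψ (f p) := by
    change ψ (f (φ.symm (φ p))) = _
    rw [hpφ]
  have himg : chartExpr E f p (f p) '' chartDomain E f p (f p) ∈ 𝓝 (ψ (f p)) := by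
    rw [← hval, ← hmap]
    exact image_mem_map ((isOpen_chartDomain hf.continuous p (f p)).mem_nhds hz)
  filter_upwards [(continuousAt_extChartAt (I := 𝓘(ℂ, E)) (f p)).preimage_mem_nhds himg,
    extChartAt_source_mem_nhds (I := 𝓘(ℂ, E)) (f p)] with q hq hqs
  obtain ⟨z, ⟨-, hz2⟩, hzq⟩ := hq
  exact ⟨_, ψ.injOn hz2 hqs hzq⟩

/-- The identity theorem spreads criticality from an open set to a whole chart ball, so the interior
is clopen. -/
theorem interior_criticalSet_eq_empty [ConnectedSpace M]
    (hf : ContMDiff 𝓘(ℂ, E) 𝓘(ℂ, E) ω f) (hreg : (criticalSet E f)ᶜ.Nonempty) :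
    interior (criticalSet E f) = ∅ := by
  have hclosed : IsClosed (interior (criticalSet E f)) := by
    rw [← closure_subset_iff_isClosed]
    intro p hp
    set φ := extChartAt 𝓘(ℂ, E) p with hφ
    have hpφ : φ.symm (φ p) = p := φ.left_inv (mem_extChartAt_source p)
    have hz : φ p ∈ chartDomain E f p (f p) :=
      ⟨φ.map_source (mem_extChartAt_source p), by
        change f (φ.symm (φ p)) ∈ (extChartAt 𝓘(ℂ, E) (f p)).source
        rw [hpφ]; exact mem_extChartAt_source _⟩
    obtain ⟨r, hr, hball⟩ := Metric.isOpen_iff.1 (isOpen_chartDomain hf.continuous p (f p)) _ hz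
    have hnhds : φ.source ∩ φ ⁻¹' Metric.ball (φ p) r ∈ 𝓝 p :=
      inter_mem (extChartAt_source_mem_nhds p)
        ((continuousAt_extChartAt p).preimage_mem_nhds (Metric.ball_mem_nhds _ hr))
    obtain ⟨q, ⟨hq1, hq2⟩, hq3⟩ := mem_closure_iff_nhds.1 hp _ hnhds
    have hev : ∀ᶠ z in 𝓝 (φ q), ¬ Function.Surjective (fderiv ℂ (chartExpr E f p (f p)) z) := by
      have h1 : ContinuousAt φ.symm (φ q) := continuousAt_extChartAt_symm' hq1
      have h2 : criticalSet E f ∈ 𝓝 (φ.symm (φ q)) := by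
        rw [φ.left_inv hq1]
        exact mem_interior_iff_mem_nhds.1 hq3
      filter_upwards [h1.preimage_mem_nhds h2, Metric.isOpen_ball.mem_nhds hq2] with z hz1 hz2
      rw [surjective_fderiv_chartExpr_iff hf (hball hz2), not_not]
      exact hz1
    have hall := ((analyticOnNhd_chartExpr hf p (f p)).mono hball).forall_not_surjective_fderiv
      (Metric.isPreconnected_ball) hq2 hev
    rw [mem_interior_iff_mem_nhds]
    filter_upwards [hnhds] with w hw
    have := hall _ hw.2
    rw [surjective_fderiv_chartExpr_iff hf (hball hw.2), not_not] at this
    rwa [← hφ, φ.left_inv hw.1] at this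
  rcases isClopen_iff.1 ⟨hclosed, isOpen_interior⟩ with h | h
  · exact h
  · obtain ⟨x, hx⟩ := hreg
    exact absurd (interior_subset (h ▸ mem_univ x)) hx

/-- Countably many charts cover `M`, and the dimension of a countable union is the supremum. -/
theorem dimH_chart_image_criticalSet_le [SecondCountableTopology M]
    (hf : ContMDiff 𝓘(ℂ, E) 𝓘(ℂ, E) ω f) (hint : interior (criticalSet E f) = ∅) (y : N) :
    dimH (extChartAt 𝓘(ℂ, E) y '' (f '' criticalSet E f ∩ (extChartAt 𝓘(ℂ, E) y).source)) ≤
      (finrank ℝ E - 2 : ℕ) := by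
  obtain ⟨s, hs, hsU⟩ := TopologicalSpace.countable_cover_nhds
    (fun p : M ↦ extChartAt_source_mem_nhds (I := 𝓘(ℂ, E)) p)
  let C : M → Set E := fun x ↦ chartExpr E f x y ''
    {z ∈ chartDomain E f x y | ¬ Function.Surjective (fderiv ℂ (chartExpr E f x y) z)}
  have hsub : extChartAt 𝓘(ℂ, E) y '' (f '' criticalSet E f ∩ (extChartAt 𝓘(ℂ, E) y).source) ⊆
      ⋃ x ∈ s, C x := by
    rintro _ ⟨_, ⟨⟨p, hp, rfl⟩, hpy⟩, rfl⟩
    obtain ⟨x, hxs, hx⟩ := mem_iUnion₂.1 (hsU.symm ▸ mem_univ p : p ∈ _)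
    have hpx := (extChartAt 𝓘(ℂ, E) x).left_inv hx
    have hz : extChartAt 𝓘(ℂ, E) x p ∈ chartDomain E f x y :=
      ⟨(extChartAt 𝓘(ℂ, E) x).map_source hx, by
        rw [mem_preimage, hpx]; exact hpy⟩
    refine mem_iUnion₂.2 ⟨x, hxs, _, ⟨hz, ?_⟩, ?_⟩
    · rw [surjective_fderiv_chartExpr_iff hf hz, not_not, hpx]
      exact hp
    · simp only [chartExpr, Function.comp_apply, hpx]
  refine (dimH_mono hsub).trans ?_
  rw [dimH_bUnion hs]
  refine iSup₂_le fun x _ ↦ (analyticOnNhd_chartExpr hf x y).dimH_image_critical_le ?_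
  intro z hz hev
  have hmem : (extChartAt 𝓘(ℂ, E) x).symm z ∈ interior (criticalSet E f) := by
    have hzs := (extChartAt 𝓘(ℂ, E) x).map_target hz.1
    rw [mem_interior_iff_mem_nhds]
    have hev' : ∀ᶠ w in 𝓝 z, (extChartAt 𝓘(ℂ, E) x).symm w ∈ criticalSet E f := by
      filter_upwards [hev, (isOpen_chartDomain hf.continuous x y).mem_nhds hz] with w hw1 hw2
      rwa [surjective_fderiv_chartExpr_iff hf hw2, not_not] at hw1
    have hc := continuousAt_extChartAt' (I := 𝓘(ℂ, E)) hzs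
    rw [ContinuousAt, (extChartAt 𝓘(ℂ, E) x).right_inv hz.1] at hc
    filter_upwards [hc.eventually hev', extChartAt_source_mem_nhds' (I := 𝓘(ℂ, E)) hzs]
      with p hp1 hp2
    rwa [(extChartAt 𝓘(ℂ, E) x).left_inv hp2] at hp1
  rw [hint] at hmem
  exact hmem

/-- A holomorphic map between equidimensional complex manifolds with a regular point and closed
image is surjective. -/
theorem surjective_of_isClosed_range_of_regular [SecondCountableTopology M] [ConnectedSpace M]
    [ConnectedSpace N] (hf : ContMDiff 𝓘(ℂ, E) 𝓘(ℂ, E) ω f)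
    (hreg : (criticalSet E f)ᶜ.Nonempty) (hclosed : IsClosed (range f)) :
    Function.Surjective f := by
  have hint := interior_criticalSet_eq_empty hf hreg
  have hcl : IsClosed (interior (range f)) := by
    rw [← closure_subset_iff_isClosed]
    intro q hq
    by_contra hq'
    set ψ := extChartAt 𝓘(ℂ, E) q with hψ
    have hqt : ψ q ∈ ψ.target := ψ.map_source (mem_extChartAt_source q)
    obtain ⟨r, hr, hball⟩ := Metric.isOpen_iff.1 (isOpen_extChartAt_target (I := 𝓘(ℂ, E)) q) _ hqt
    have hnhds : ψ.source ∩ ψ ⁻¹' Metric.ball (ψ q) r ∈ 𝓝 q :=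
      inter_mem (extChartAt_source_mem_nhds q)
        ((continuousAt_extChartAt q).preimage_mem_nhds (Metric.ball_mem_nhds _ hr))
    have hopen : ∀ {O : Set N}, IsOpen O → IsOpen (ψ.target ∩ ψ.symm ⁻¹' O) := fun hO ↦
      (continuousOn_extChartAt_symm q).isOpen_inter_preimage (isOpen_extChartAt_target q) hO
    have hU := hopen (isOpen_interior (s := range f))
    have hV := hopen hclosed.isOpen_compl
    have hUV : Disjoint (ψ.target ∩ ψ.symm ⁻¹' interior (range f))
        (ψ.target ∩ ψ.symm ⁻¹' (range f)ᶜ) :=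
      disjoint_left.2 fun z hz1 hz2 ↦ hz2.2 (interior_subset hz1.2)
    have hmeet : ∀ {O : Set N}, q ∈ closure O →
        (Metric.ball (ψ q) r ∩ (ψ.target ∩ ψ.symm ⁻¹' O)).Nonempty := fun hO ↦ by
      obtain ⟨a, ⟨ha1, ha2⟩, ha3⟩ := mem_closure_iff_nhds.1 hO _ hnhds
      exact ⟨ψ a, ha2, ψ.map_source ha1, by rwa [mem_preimage, ψ.left_inv ha1]⟩
    have hBU := hmeet hq
    have hBV := hmeet (O := (range f)ᶜ) (by rwa [closure_compl])
    refine (convex_ball (ψ q) r).not_separated_of_dimH_lt Metric.isOpen_ball hU hV hUV hBU hBV ?_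
    -- In dimension zero truncated subtraction would make both bounds `0`; two disjoint nonempty
    -- sets exclude this case.
    have hfin : 0 < finrank ℝ E := by
      obtain ⟨a, -, ha⟩ := hBU
      obtain ⟨b, -, hb⟩ := hBV
      have : Nontrivial E := ⟨a, b, hUV.ne_of_mem ha hb⟩
      exact finrank_pos
    have hfin2 : finrank ℝ E = 2 * finrank ℂ E := finrank_real_of_complex E
    refine lt_of_le_of_lt ((dimH_mono ?_).trans (dimH_chart_image_criticalSet_le hf hint q))
      (Nat.cast_lt.2 (by omega : finrank ℝ E - 2 < finrank ℝ E - 1))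
    -- Outside both open sets, `ψ.symm z` is in the range but not in its interior, so any preimage
    -- is critical.
    rintro z ⟨hzB, hz⟩
    have hzt := hball hzB
    have hzr : ψ.symm z ∈ range f := by
      by_contra h
      exact hz (Or.inr ⟨hzt, h⟩)
    obtain ⟨p, hp⟩ := hzr
    refine ⟨ψ.symm z, ⟨⟨p, ?_, hp⟩, ψ.map_target hzt⟩, ψ.right_inv hzt⟩
    by_contra hpc
    refine hz (Or.inl ⟨hzt, ?_⟩)
    rw [mem_preimage, ← hp, mem_interior_iff_mem_nhds]
    exact range_mem_nhds_of_notMem_criticalSet hf hpc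
  rcases isClopen_iff.1 ⟨hcl, isOpen_interior⟩ with h | h
  · obtain ⟨p, hp⟩ := hreg
    have := mem_interior_iff_mem_nhds.2 (range_mem_nhds_of_notMem_criticalSet hf hp)
    rw [h] at this
    exact this.elim
  · exact range_eq_univ.1 (univ_subset_iff.1 (h ▸ interior_subset))

end Manifold

theorem corollary1p6 (n : ℕ)
    {M : Type*} [TopologicalSpace M] [T2Space M] [SecondCountableTopology M] [ConnectedSpace M]
    [ChartedSpace (EuclideanSpace ℂ (Fin n)) M]
    [IsManifold 𝓘(ℂ, EuclideanSpace ℂ (Fin n)) ω M]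
    {N : Type*} [TopologicalSpace N] [T2Space N] [SecondCountableTopology N] [ConnectedSpace N]
    [ChartedSpace (EuclideanSpace ℂ (Fin n)) N]
    [IsManifold 𝓘(ℂ, EuclideanSpace ℂ (Fin n)) ω N]
    (f : M → N)
    (hf : ContMDiff 𝓘(ℂ, EuclideanSpace ℂ (Fin n)) 𝓘(ℂ, EuclideanSpace ℂ (Fin n)) ω f)
    (hreg : ∃ p : M, Function.Surjective
      (mfderiv 𝓘(ℂ, EuclideanSpace ℂ (Fin n)) 𝓘(ℂ, EuclideanSpace ℂ (Fin n)) f p))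
    (hclosed : IsClosed (Set.range f)) :
    Function.Surjective f :=
  surjective_of_isClosed_range_of_regular hf (hreg.imp fun _ h ↦ not_not.2 h) hclosed
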